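/- Let $\mathsf{CAR}_1$ be the universal enveloping $C^*$-algebra of the unital $*$-algebra $\mathbb C\langle a,a^*\mid a^*a+aa^*=1\rangle$, i.e. its (Hausdorff) completion with respect to the $C^*$-seminorm $\|b\|=\sup_\pi\|\pi(b)\|$, where $\pi$ runs over the $*$-representations by bounded operators on Hilbert spaces; write $a$ also for the generator of $\mathsf{CAR}_1$. Let $\mathbb T=\{z\in\mathbb C:|z|=1\}$, let $D_2\subset M_2=M_2(\mathbb C)$ be the diagonal matrices, and put $$W(z)=\begin{pmatrix}1&0\\0&z\end{pmatrix}\ (z\in\mathbb T),\qquad W=W(-1)=\begin{pmatrix}1&0\\0&-1\end{pmatrix},\qquad V=\frac1{\sqrt2}\begin{pmatrix}1&1\\1&-1\end{pmatrix}.$$ Let $\mathcal B$ be the set of all $f\in C\left(\left[0,\tfrac12\right],M_2(C(\mathbb T))\right)$ such that 1. $f(x)(z)=W f(x)(-z)W^*$ for all $x\in\left(0,\tfrac12\right)$ and $z\in\mathbb T$; 2. $f(0)(z)=W(z)f(0)(1)W(z)^*$ for all $z\in\mathbb T$; 3. $f\left(\tfrac12\right)\in V(D_2\otimes C(\mathbb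 T))V^*$, and $f\left(\tfrac12\right)(z)=Wf\left(\tfrac12\right)(-z)W^*$ for all $z\in\mathbb T$. Then $\mathcal B$ is a $C^*$-subalgebra (a norm-closed $*$-subalgebra) of $C\left(\left[0,\tfrac12\right],M_2(C(\mathbb T))\right)$. There is exactly one unital $*$-homomorphism $h:\mathsf{CAR}_1\to C\left(\left[0,\tfrac12\right],M_2(C(\mathbb T))\right)$ with $$h(a)(x)(z)=z\begin{pmatrix}0&\sqrt x\\ \sqrt{1-x}&0\end{pmatrix},\qquad x\in\left[0,\tfrac12\right],\ z\in\mathbb T,$$ and $h$ is a $*$-isomorphism of $\mathsf{CAR}_1$ onto $\mathcal B$. -/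

import Mathlib

open scoped ComplexOrder

noncomputable section
namespace CARAlgebra

/-- The free unital `*`-algebra over `ℂ` on one generator: the free algebra on the two letters
`a` and `a*`, with the conjugate-linear anti-multiplicative involution exchanging the letters. -/
def FreeStar : Type := FreeAlgebra ℂ Bool

namespace FreeStar

instance : Ring FreeStar := inferInstanceAs (Ring (FreeAlgebra ℂ Bool))
instance : Algebra ℂ FreeStar := inferInstanceAs (Algebra ℂ (FreeAlgebra ℂ Bool))

/-- The letters: `false` stands for `a`, `true` for `a*`. -/
def letter (b : Bool) : FreeStar := FreeAlgebra.ι ℂ b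

/-- The conjugate scalar action on the opposite algebra. -/
abbrev conjAlgebra : Algebra ℂ FreeStarᵐᵒᵖ :=
  ((algebraMap ℂ FreeStarᵐᵒᵖ).comp (starRingEnd ℂ)).toAlgebra'
    (fun c x => Algebra.commutes (starRingEnd ℂ c) x)

/-- The conjugate-linear involution exchanging `a` and `a*`, as a map to the opposite ring. -/
def starHom : FreeStar →+* FreeStarᵐᵒᵖ :=
  letI := conjAlgebra
  (FreeAlgebra.lift ℂ (fun b : Bool => MulOpposite.op (letter (!b))) :
    FreeAlgebra ℂ Bool →ₐ[ℂ] FreeStarᵐᵒᵖ).toRingHom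

theorem starHom_letter (b : Bool) : starHom (letter b) = MulOpposite.op (letter (!b)) :=
  letI := conjAlgebra
  FreeAlgebra.lift_ι_apply (R := ℂ) (fun b : Bool => MulOpposite.op (letter (!b))) b

theorem starHom_algebraMap (c : ℂ) :
    starHom (algebraMap ℂ FreeStar c) =
      MulOpposite.op (algebraMap ℂ FreeStar (starRingEnd ℂ c)) :=
  letI := conjAlgebra
  AlgHom.commutes (FreeAlgebra.lift ℂ (fun b : Bool => MulOpposite.op (letter (!b))) :
    FreeAlgebra ℂ Bool →ₐ[ℂ] FreeStarᵐᵒᵖ) c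

theorem induction {P : FreeStar → Prop} (h1 : ∀ c : ℂ, P (algebraMap ℂ FreeStar c))
    (h2 : ∀ b, P (letter b)) (h3 : ∀ x y, P x → P y → P (x * y))
    (h4 : ∀ x y, P x → P y → P (x + y)) (x : FreeStar) : P x :=
  FreeAlgebra.induction ℂ Bool (motive := P) h1 h2 h3 h4 x

instance : StarRing FreeStar where
  star x := (starHom x).unop
  star_involutive x := by
    change (starHom (starHom x).unop).unop = x
    induction x using induction with
    | h1 c => simp [starHom_algebraMap]
    | h2 b => simp [starHom_letter]
    | h3 x y hx hy => simp [hx, hy]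
    | h4 x y hx hy => simp [hx, hy]
  star_mul x y := by
    change (starHom (x * y)).unop = (starHom y).unop * (starHom x).unop
    simp
  star_add x y := by
    change (starHom (x + y)).unop = (starHom x).unop + (starHom y).unop
    simp

theorem star_letter (b : Bool) : star (letter b) = letter (!b) :=
  congrArg MulOpposite.unop (starHom_letter b)

theorem star_algebraMap (c : ℂ) :
    star (algebraMap ℂ FreeStar c) = algebraMap ℂ FreeStar (star c) :=
  congrArg MulOpposite.unop (starHom_algebraMap c)

instance : StarModule ℂ FreeStar where
  star_smul c x := by
    rw [Algebra.smul_def, star_mul, star_algebraMap, ← Algebra.commutes, ← Algebra.smul_def]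

/-- The free generator. -/
def a : FreeStar := letter false

end FreeStar

/-- The relation `a* a + a a* = 1`. -/
inductive Rel : FreeStar → FreeStar → Prop
  | anti : Rel (star FreeStar.a * FreeStar.a + FreeStar.a * star FreeStar.a) 1

theorem Rel.star_closed : ∀ x y, Rel x y → Rel (star x) (star y) := by
  rintro _ _ ⟨⟩
  simpa using Rel.anti

/-- The unital `*`-algebra `ℂ⟨a, a* | a* a + a a* = 1⟩`. -/
def Poly : Type := RingQuot Rel
namespace Poly

instance : Ring Poly := inferInstanceAs (Ring (RingQuot Rel))
instance : Algebra ℂ Poly := inferInstanceAs (Algebra ℂ (RingQuot Rel))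
instance : StarRing Poly := RingQuot.starRing Rel Rel.star_closed
/-- The quotient map. -/
def mk : FreeStar →ₐ[ℂ] Poly := RingQuot.mkAlgHom ℂ Rel

theorem star_mk (x : FreeStar) : star (mk x) = mk (star x) := by
  simp [mk, RingQuot.mkAlgHom_def, RingQuot.mkRingHom_def]
  rfl
end Poly

namespace Poly

theorem mk_surjective : Function.Surjective mk := RingQuot.mkAlgHom_surjective ℂ Rel

instance : StarModule ℂ Poly where
  star_smul c x := by
    obtain ⟨x, rfl⟩ := mk_surjective x
    rw [← map_smul, star_mk, star_mk, star_smul, map_smul]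

/-- The generator `a`. -/
def gen : Poly := mk FreeStar.a

theorem gen_rel : star gen * gen + gen * star gen = 1 := by
  have h := RingQuot.mkAlgHom_rel ℂ Rel.anti
  rw [map_add, map_mul, map_mul, map_one] at h
  unfold gen
  rw [star_mk]
  exact h

/-- The set of all norms `‖π x‖`, where `π` is a (unital) `*`-representation by bounded
operators on a complex Hilbert space. -/
def repNorms (x : Poly) : Set ℝ :=
  {r | ∃ (H : Type) (_ : NormedAddCommGroup H) (_ : InnerProductSpace ℂ H) (_ : CompleteSpace H)
    (π : Poly →⋆ₐ[ℂ] (H →L[ℂ] H)), r = ‖π x‖}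

theorem repNorms_nonempty (x : Poly) : (repNorms x).Nonempty := by
  let π : Poly →⋆ₐ[ℂ] (PUnit.{1} →L[ℂ] PUnit.{1}) :=
    { toFun := fun _ => 0
      map_one' := Subsingleton.elim _ _
      map_mul' := fun _ _ => Subsingleton.elim _ _
      map_zero' := rfl
      map_add' := fun _ _ => Subsingleton.elim _ _
      commutes' := fun _ => Subsingleton.elim _ _
      map_star' := fun _ => Subsingleton.elim _ _ }
  exact ⟨_, PUnit, inferInstance, inferInstance, inferInstance, π, rfl⟩

section Bound

variable {H : Type} [NormedAddCommGroup H] [InnerProductSpace ℂ H] [CompleteSpace H]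

theorem norm_le_one_of_rel (T : H →L[ℂ] H) (hT : star T * T + T * star T = 1) : ‖T‖ ≤ 1 := by
  refine T.opNorm_le_bound zero_le_one fun v => ?_
  have h1 : inner ℂ ((star T * T + T * star T) v) v = inner ℂ v v := by rw [hT]; rfl
  have h2 : inner ℂ ((star T * T) v) v = inner ℂ (T v) (T v) :=
    ContinuousLinearMap.adjoint_inner_left T v (T v)
  have h3 : inner ℂ ((T * star T) v) v = inner ℂ ((star T) v) ((star T) v) :=
    (ContinuousLinearMap.adjoint_inner_right T (star T v) v).symm
  rw [_root_.add_apply, inner_add_left, h2, h3] at h1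
  simp only [inner_self_eq_norm_sq_to_K] at h1
  have h4 : ‖T v‖ ^ 2 + ‖(star T) v‖ ^ 2 = ‖v‖ ^ 2 := by exact_mod_cast h1
  rw [one_mul]
  exact le_of_sq_le_sq (by nlinarith [sq_nonneg ‖(star T) v‖]) (norm_nonneg v)

theorem norm_map_gen_le (π : Poly →⋆ₐ[ℂ] (H →L[ℂ] H)) : ‖π gen‖ ≤ 1 := by
  refine norm_le_one_of_rel _ ?_
  rw [← map_star, ← map_mul, ← map_mul, ← map_add, gen_rel, map_one]

end Bound

theorem repNorms_bddAbove (x : Poly) : BddAbove (repNorms x) := by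
  suffices h : ∃ C : ℝ, ∀ (H : Type) [NormedAddCommGroup H] [InnerProductSpace ℂ H]
      [CompleteSpace H] (π : Poly →⋆ₐ[ℂ] (H →L[ℂ] H)), ‖π x‖ ≤ C by
    obtain ⟨C, hC⟩ := h
    refine ⟨C, ?_⟩
    rintro r ⟨H, _, _, _, π, rfl⟩
    exact hC H π
  obtain ⟨x, rfl⟩ := mk_surjective x
  induction x using FreeStar.induction with
  | h1 c =>
    refine ⟨‖c‖, fun H _ _ _ π => ?_⟩
    rw [AlgHom.commutes, AlgHomClass.commutes, Algebra.algebraMap_eq_smul_one]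
    calc ‖c • (1 : H →L[ℂ] H)‖ ≤ ‖c‖ * ‖(1 : H →L[ℂ] H)‖ := norm_smul_le _ _
      _ ≤ ‖c‖ * 1 := by gcongr; exact ContinuousLinearMap.norm_id_le
      _ = ‖c‖ := mul_one _
  | h2 b =>
    refine ⟨1, fun H _ _ _ π => ?_⟩
    cases b with
    | false => exact norm_map_gen_le π
    | true =>
      have : mk (FreeStar.letter true) = star gen := by
        rw [gen, star_mk]; exact congrArg mk (FreeStar.star_letter false).symm
      rw [this, map_star, norm_star]
      exact norm_map_gen_le π
  | h3 x y hx hy =>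
    obtain ⟨C, hC⟩ := hx
    obtain ⟨D, hD⟩ := hy
    refine ⟨C * D, fun H _ _ _ π => ?_⟩
    rw [map_mul, map_mul]
    exact (norm_mul_le _ _).trans
      (mul_le_mul (hC H π) (hD H π) (norm_nonneg _) ((norm_nonneg _).trans (hC H π)))
  | h4 x y hx hy =>
    obtain ⟨C, hC⟩ := hx
    obtain ⟨D, hD⟩ := hy
    refine ⟨C + D, fun H _ _ _ π => ?_⟩
    rw [map_add, map_add]
    exact (norm_add_le _ _).trans (add_le_add (hC H π) (hD H π))

/-- The universal `C*`-seminorm `‖x‖ = sup_π ‖π x‖`. -/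
instance : Norm Poly := ⟨fun x => sSup (repNorms x)⟩

theorem norm_def (x : Poly) : ‖x‖ = sSup (repNorms x) := rfl

theorem norm_map_le {H : Type} [NormedAddCommGroup H] [InnerProductSpace ℂ H] [CompleteSpace H]
    (π : Poly →⋆ₐ[ℂ] (H →L[ℂ] H)) (x : Poly) : ‖π x‖ ≤ ‖x‖ :=
  le_csSup (repNorms_bddAbove x) ⟨H, _, _, _, π, rfl⟩

theorem norm_le {x : Poly} {C : ℝ} (h : ∀ (H : Type) [NormedAddCommGroup H]
    [InnerProductSpace ℂ H] [CompleteSpace H] (π : Poly →⋆ₐ[ℂ] (H →L[ℂ] H)), ‖π x‖ ≤ C) :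
    ‖x‖ ≤ C := by
  refine csSup_le (repNorms_nonempty x) ?_
  rintro r ⟨H, _, _, _, π, rfl⟩
  exact h H π

theorem norm_nonneg' (x : Poly) : 0 ≤ ‖x‖ := by
  obtain ⟨r, hr⟩ := repNorms_nonempty x
  have h := le_csSup (repNorms_bddAbove x) hr
  obtain ⟨H, _, _, _, π, rfl⟩ := hr
  exact (norm_nonneg _).trans h

instance : SeminormedAddCommGroup Poly :=
  AddGroupSeminorm.toSeminormedAddCommGroup
    { toFun := fun x => ‖x‖
      map_zero' := le_antisymm (norm_le fun H _ _ _ π => by simp) (norm_nonneg' 0)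
      add_le' := fun x y => norm_le fun H _ _ _ π => by
        rw [map_add]
        exact (norm_add_le _ _).trans (add_le_add (norm_map_le π x) (norm_map_le π y))
      neg' := fun x => by
        have h : ∀ y : Poly, ‖-y‖ ≤ ‖y‖ := fun y => norm_le fun H _ _ _ π => by
          rw [map_neg, norm_neg]; exact norm_map_le π y
        exact le_antisymm (h x) (by simpa using h (-x)) }

instance : SeminormedRing Poly where
  __ := (inferInstance : SeminormedAddCommGroup Poly)
  __ := (inferInstance : Ring Poly)
  norm_mul_le x y := norm_le fun H _ _ _ π => by
    rw [map_mul]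
    exact (norm_mul_le _ _).trans (mul_le_mul (norm_map_le π x) (norm_map_le π y)
      (norm_nonneg _) (norm_nonneg' x))

instance : NormedAlgebra ℂ Poly where
  __ := (inferInstance : Algebra ℂ Poly)
  norm_smul_le c x := norm_le fun H _ _ _ π => by
    rw [map_smul, norm_smul]
    exact mul_le_mul_of_nonneg_left (norm_map_le π x) (norm_nonneg c)

theorem norm_star_le (x : Poly) : ‖star x‖ ≤ ‖x‖ := norm_le fun H _ _ _ π => by
  rw [map_star, norm_star]; exact norm_map_le π x

instance : NormedStarGroup Poly := ⟨norm_star_le⟩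

theorem norm_mul_self_le (x : Poly) : ‖x‖ * ‖x‖ ≤ ‖star x * x‖ := by
  have h : ‖x‖ ≤ √‖star x * x‖ := norm_le fun H _ _ _ π => by
    refine Real.le_sqrt_of_sq_le ?_
    rw [sq, ← CStarRing.norm_star_mul_self, ← map_star, ← map_mul]
    exact norm_map_le π _
  calc ‖x‖ * ‖x‖ ≤ √‖star x * x‖ * √‖star x * x‖ :=
        mul_le_mul h h (norm_nonneg x) (Real.sqrt_nonneg _)
    _ = ‖star x * x‖ := Real.mul_self_sqrt (norm_nonneg _)

end Poly

/-- The universal enveloping `C*`-algebra of `Poly` : the (Hausdorff) completion with respect to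
the universal `C*`-seminorm. -/
def CAR₁ : Type := UniformSpace.Completion Poly

namespace CAR₁

open UniformSpace

instance : NormedRing CAR₁ := inferInstanceAs (NormedRing (Completion Poly))
instance : CompleteSpace CAR₁ := inferInstanceAs (CompleteSpace (Completion Poly))
instance : NormedAlgebra ℂ CAR₁ where
  __ := (inferInstance : Algebra ℂ (Completion Poly))
  norm_smul_le c x := norm_smul_le c (show Completion Poly from x)

/-- The canonical map from the `*`-algebra to its completion. -/
def of : Poly → CAR₁ := fun x => (x : Completion Poly)

theorem of_mul (x y : Poly) : of (x * y) = of x * of y := Completion.coe_mul x y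
theorem of_add (x y : Poly) : of (x + y) = of x + of y := Completion.coe_add x y
theorem of_smul (c : ℂ) (x : Poly) : of (c • x) = c • of x := Completion.coe_smul c x
theorem norm_of (x : Poly) : ‖of x‖ = ‖x‖ := Completion.norm_coe x
theorem continuous_of : Continuous of := Completion.continuous_coe Poly
theorem denseRange_of : DenseRange of := Completion.denseRange_coe

instance : Star CAR₁ := ⟨Completion.map (star : Poly → Poly)⟩

theorem uniformContinuous_star : UniformContinuous (star : Poly → Poly) :=
  (LipschitzWith.of_dist_le_mul (K := 1) fun x y => by
    rw [dist_eq_norm, dist_eq_norm, ← star_sub, norm_star, NNReal.coe_one, one_mul]).uniformContinuous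

theorem star_of (x : Poly) : star (of x) = of (star x) :=
  Completion.map_coe uniformContinuous_star x

theorem continuous_star' : Continuous (star : CAR₁ → CAR₁) := Completion.continuous_map

instance : StarRing CAR₁ where
  star_involutive x := by
    refine denseRange_of.induction_on (p := fun x => star (star x) = x) x
      (isClosed_eq (continuous_star'.comp continuous_star') continuous_id) fun x => ?_
    rw [star_of, star_of, star_star]
  star_mul x y := by
    refine denseRange_of.induction_on₂ (p := fun x y => star (x * y) = star y * star x)
      (isClosed_eq (continuous_star'.comp continuous_mul)
        ((continuous_star'.comp continuous_snd).mul (continuous_star'.comp continuous_fst)))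
      (fun x y => ?_) x y
    simp only [← of_mul, star_of, star_mul]
  star_add x y := by
    refine denseRange_of.induction_on₂ (p := fun x y => star (x + y) = star x + star y)
      (isClosed_eq (continuous_star'.comp continuous_add)
        ((continuous_star'.comp continuous_fst).add (continuous_star'.comp continuous_snd)))
      (fun x y => ?_) x y
    simp only [← of_add, star_of, star_add]

instance : CStarRing CAR₁ where
  norm_mul_self_le x := by
    refine denseRange_of.induction_on (p := fun x => ‖x‖ * ‖x‖ ≤ ‖star x * x‖) x
      (isClosed_le (continuous_norm.mul continuous_norm)
        (continuous_norm.comp (continuous_star'.mul continuous_id))) fun x => ?_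
    rw [star_of, ← of_mul, norm_of, norm_of]
    exact Poly.norm_mul_self_le x

instance : StarModule ℂ CAR₁ where
  star_smul c x := by
    refine denseRange_of.induction_on (p := fun x => star (c • x) = star c • star x) x
      (isClosed_eq (continuous_star'.comp (continuous_const_smul c))
        (continuous_star'.const_smul (star c))) fun x => ?_
    rw [← of_smul, star_of, star_of, ← of_smul, star_smul]

instance : CStarAlgebra CAR₁ where

/-- The generator `a` of `CAR₁`. -/
def a : CAR₁ := of Poly.gen

end CAR₁

/-! ### The algebra `B` -/

open scoped Matrix

/-- `M₂(C(𝕋))` with its `C*`-norm. -/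
def MatCT : Type := CStarMatrix (Fin 2) (Fin 2) C(Circle, ℂ)

instance : CStarAlgebra MatCT :=
  inferInstanceAs (CStarAlgebra (CStarMatrix (Fin 2) (Fin 2) C(Circle, ℂ)))

/-- The `(i, j)` entry of a matrix in `M₂(C(𝕋))`. -/
def MatCT.entry (M : MatCT) (i j : Fin 2) : C(Circle, ℂ) :=
  (show CStarMatrix (Fin 2) (Fin 2) C(Circle, ℂ) from M) i j

/-- The interval `[0, 1/2]`. -/
abbrev HalfInterval : Type := Set.Icc (0 : ℝ) (1 / 2)

/-- `C([0, 1/2], M₂(C(𝕋)))`. -/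
abbrev FunAlg : Type := C(HalfInterval, MatCT)

/-- The point `0`. -/
def leftEnd : HalfInterval := ⟨0, by norm_num⟩
/-- The point `1/2`. -/
def rightEnd : HalfInterval := ⟨1 / 2, by norm_num⟩

/-- `f(x)(z) ∈ M₂(ℂ)`. -/
def evalAt (f : FunAlg) (x : HalfInterval) (z : Circle) : Matrix (Fin 2) (Fin 2) ℂ :=
  Matrix.of fun i j => (f x).entry i j z

/-- `W(z) = diag(1, z)`. -/
def W (z : Circle) : Matrix (Fin 2) (Fin 2) ℂ := !![1, 0; 0, (z : ℂ)]

/-- The unitary `V = 2^{-1/2} (1 1; 1 -1)`. -/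
def V : Matrix (Fin 2) (Fin 2) ℂ := ((1 / √2 : ℝ) : ℂ) • !![1, 1; 1, -1]

theorem evalAt_mul (f g : FunAlg) (x : HalfInterval) (z : Circle) :
    evalAt (f * g) x z = evalAt f x z * evalAt g x z := by
  have h (M N : MatCT) (i j : Fin 2) : (M * N).entry i j = ∑ k, M.entry i k * N.entry k j :=
    CStarMatrix.mul_apply
  ext i j
  simp [evalAt, h, Matrix.mul_apply]

theorem evalAt_add (f g : FunAlg) (x : HalfInterval) (z : Circle) :
    evalAt (f + g) x z = evalAt f x z + evalAt g x z := rfl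

theorem evalAt_star (f : FunAlg) (x : HalfInterval) (z : Circle) :
    evalAt (star f) x z = (evalAt f x z)ᴴ := rfl

theorem evalAt_algebraMap (c : ℂ) (x : HalfInterval) (z : Circle) :
    evalAt (algebraMap ℂ FunAlg c) x z = algebraMap ℂ (Matrix (Fin 2) (Fin 2) ℂ) c := by
  have h (i j : Fin 2) : (1 : MatCT).entry i j = if i = j then 1 else 0 := CStarMatrix.one_apply
  have h' (M : MatCT) (i j : Fin 2) : (c • M).entry i j = c • M.entry i j := rfl
  ext i j
  fin_cases i <;> fin_cases j <;> simp [evalAt, Algebra.algebraMap_eq_smul_one, h, h']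

theorem W_star_mul (z : Circle) : (W z)ᴴ * W z = 1 := by
  have h : (starRingEnd ℂ) (z : ℂ) * (z : ℂ) = 1 := by
    rw [← Circle.coe_inv_eq_conj, ← Circle.coe_mul, inv_mul_cancel, Circle.coe_one]
  ext i j
  fin_cases i <;> fin_cases j <;> simp [W, Matrix.mul_apply, h]

theorem W_mul_star (z : Circle) : W z * (W z)ᴴ = 1 := mul_eq_one_comm.mp (W_star_mul z)

theorem V_star_mul : Vᴴ * V = 1 := by
  have h : ((√2 : ℝ) : ℂ)⁻¹ * ((√2 : ℝ) : ℂ)⁻¹ = 1 / 2 := by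
    rw [← mul_inv, ← Complex.ofReal_mul, Real.mul_self_sqrt (by norm_num)]; norm_num
  ext i j
  fin_cases i <;> fin_cases j <;> simp [V, Matrix.mul_apply, h] <;> norm_num

theorem V_mul_star : V * Vᴴ = 1 := mul_eq_one_comm.mp V_star_mul

theorem conj_mul {U M N : Matrix (Fin 2) (Fin 2) ℂ} (hU : Uᴴ * U = 1) :
    (U * M * Uᴴ) * (U * N * Uᴴ) = U * (M * N) * Uᴴ := by
  calc (U * M * Uᴴ) * (U * N * Uᴴ) = U * M * (Uᴴ * U) * N * Uᴴ := by noncomm_ring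
    _ = U * (M * N) * Uᴴ := by rw [hU]; noncomm_ring

theorem conj_add (U M N : Matrix (Fin 2) (Fin 2) ℂ) :
    (U * M * Uᴴ) + (U * N * Uᴴ) = U * (M + N) * Uᴴ := by noncomm_ring

theorem conj_star (U M : Matrix (Fin 2) (Fin 2) ℂ) :
    (U * M * Uᴴ)ᴴ = U * Mᴴ * Uᴴ := by
  simp [Matrix.conjTranspose_mul, mul_assoc]

theorem conj_algebraMap {U : Matrix (Fin 2) (Fin 2) ℂ} (hU : U * Uᴴ = 1) (c : ℂ) :
    algebraMap ℂ _ c = U * algebraMap ℂ (Matrix (Fin 2) (Fin 2) ℂ) c * Uᴴ := by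
  rw [← Algebra.commutes, mul_assoc, hU, mul_one]

/-- The defining conditions of the algebra `B`; note `W(-1) = W`. The condition `diag_right` says
that `f(1/2)` lies in `V (D₂ ⊗ C(𝕋)) V*`, where `D₂ ⊗ C(𝕋)` consists of the diagonal matrices with
entries in `C(𝕋)`. -/
structure MemB (f : FunAlg) : Prop where
  symm_interior : ∀ x : HalfInterval, 0 < (x : ℝ) → (x : ℝ) < 1 / 2 → ∀ z : Circle,
    evalAt f x z = W (-1) * evalAt f x (-z) * (W (-1))ᴴ
  conj_left : ∀ z : Circle, evalAt f leftEnd z = W z * evalAt f leftEnd 1 * (W z)ᴴ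
  diag_right : ∃ d : Fin 2 → C(Circle, ℂ), ∀ z : Circle,
    evalAt f rightEnd z = V * Matrix.diagonal (fun i => d i z) * Vᴴ
  symm_right : ∀ z : Circle,
    evalAt f rightEnd z = W (-1) * evalAt f rightEnd (-z) * (W (-1))ᴴ

/-- The `*`-subalgebra `B` of `C([0, 1/2], M₂(C(𝕋)))`. -/
def B : StarSubalgebra ℂ FunAlg where
  carrier := {f | MemB f}
  mul_mem' {f g} hf hg := by
    refine ⟨fun x h0 h1 z => ?_, fun z => ?_, ?_, fun z => ?_⟩
    · rw [evalAt_mul, evalAt_mul, hf.symm_interior x h0 h1 z, hg.symm_interior x h0 h1 z,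
        conj_mul (W_star_mul _)]
    · rw [evalAt_mul, evalAt_mul, hf.conj_left z, hg.conj_left z, conj_mul (W_star_mul _)]
    · obtain ⟨d, hd⟩ := hf.diag_right
      obtain ⟨e, he⟩ := hg.diag_right
      refine ⟨fun i => d i * e i, fun z => ?_⟩
      rw [evalAt_mul, hd, he, conj_mul V_star_mul, Matrix.diagonal_mul_diagonal]
      rfl
    · rw [evalAt_mul, evalAt_mul, hf.symm_right z, hg.symm_right z, conj_mul (W_star_mul _)]
  add_mem' {f g} hf hg := by
    refine ⟨fun x h0 h1 z => ?_, fun z => ?_, ?_, fun z => ?_⟩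
    · rw [evalAt_add, evalAt_add, hf.symm_interior x h0 h1 z, hg.symm_interior x h0 h1 z, conj_add]
    · rw [evalAt_add, evalAt_add, hf.conj_left z, hg.conj_left z, conj_add]
    · obtain ⟨d, hd⟩ := hf.diag_right
      obtain ⟨e, he⟩ := hg.diag_right
      refine ⟨fun i => d i + e i, fun z => ?_⟩
      rw [evalAt_add, hd, he, conj_add, Matrix.diagonal_add]
      rfl
    · rw [evalAt_add, evalAt_add, hf.symm_right z, hg.symm_right z, conj_add]
  algebraMap_mem' c := by
    refine ⟨fun x _ _ z => ?_, fun z => ?_, ⟨fun _ => ContinuousMap.const _ c, fun z => ?_⟩,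
      fun z => ?_⟩
    · rw [evalAt_algebraMap, evalAt_algebraMap, ← conj_algebraMap (W_mul_star _)]
    · rw [evalAt_algebraMap, evalAt_algebraMap, ← conj_algebraMap (W_mul_star _)]
    · rw [evalAt_algebraMap, conj_algebraMap V_mul_star c]
      rfl
    · rw [evalAt_algebraMap, evalAt_algebraMap, ← conj_algebraMap (W_mul_star _)]
  star_mem' {f} hf := by
    refine ⟨fun x h0 h1 z => ?_, fun z => ?_, ?_, fun z => ?_⟩
    · rw [evalAt_star, evalAt_star, hf.symm_interior x h0 h1 z, conj_star]
    · rw [evalAt_star, evalAt_star, hf.conj_left z, conj_star]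
    · obtain ⟨d, hd⟩ := hf.diag_right
      refine ⟨fun i => star (d i), fun z => ?_⟩
      rw [evalAt_star, hd, conj_star, Matrix.diagonal_conjTranspose]
      rfl
    · rw [evalAt_star, evalAt_star, hf.symm_right z, conj_star]

end CARAlgebra
end

open CARAlgebra

/-!
# The C*-algebra of one canonical anticommutation relation as an algebra of matrix functions

In `ℂ⟨a, a* | a* a + a a* = 1⟩` the elements `a²` and `a*²` are central, and over the central
subalgebra they generate the algebra is spanned by `1, a, a*, a a*`
(`Poly.exists_central_coeff`): it behaves like an algebra of `2 × 2` matrices in which `a` is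
traceless. In `CAR₁` the element `a²` is normal of norm at most `1/2`, so continuous functions on
the disc of radius `1/2` act on `CAR₁` through the functional calculus of `a²`. At the point
`(x, z)` the element `a²` acts as the scalar `coord x z = z² √(x (1 - x))`, and these scalars fill
the whole disc.

*Injectivity.* The anti-automorphism `adj` with `a ↦ -a`, `a* ↦ -a*` becomes the adjugate of
`2 × 2` matrices under evaluation, and the trace `y + adj y` is central (`add_adj_mem_central`).
Since `adj (b* b) = adj b (adj b)*` is positive, `b* b` is at most its trace. The trace is a
function of `a²`, and its norm is at most the supremum of its values at the points `(x, z)`, which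
are traces of matrices. This gives `‖b‖² ≤ 2 ‖h b‖²` (`sq_norm_le_two_mul`), so `h` is injective
with closed range, and no classification of representations is required.

*Surjectivity.* A function in `B` that vanishes at one point of a fibre of `coord` vanishes on that
fibre (`MemB.evalAt_eq_zero`): this is what the boundary and symmetry conditions say. Its value at
a single point is the value of some element of the `*`-algebra (`exists_evalAt_polyHom_eq`).
Hence each `F ∈ B` is approximated by the range near every fibre, and a partition of unity on the
disc, transported into `CAR₁` by the functional calculus of `a²`, glues these approximations.
-/

noncomputable section
namespace CARAlgebra

open scoped Matrix CStarAlgebra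

namespace Poly

/-! ### The `*`-algebra generated by `a` -/

/-- Induction along words in `a` and `a*`. -/
theorem induction_gen {P : Poly → Prop} (algebraMap : ∀ c : ℂ, P (algebraMap ℂ Poly c))
    (gen : P Poly.gen) (star_gen : P (star Poly.gen)) (mul : ∀ x y, P x → P y → P (x * y))
    (add : ∀ x y, P x → P y → P (x + y)) (x : Poly) : P x := by
  obtain ⟨x, rfl⟩ := mk_surjective x
  induction x using FreeStar.induction with
  | h1 c => rw [AlgHom.commutes]; exact algebraMap c
  | h2 b =>
    cases b with
    | false => exact gen
    | true =>
      have h : mk (FreeStar.letter true) = star Poly.gen := by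
        rw [Poly.gen, star_mk, FreeStar.a, FreeStar.star_letter]; rfl
      rwa [h]
  | h3 x y hx hy => rw [map_mul]; exact mul _ _ hx hy
  | h4 x y hx hy => rw [map_add]; exact add _ _ hx hy

section Lift

variable {S : Type*} [Ring S] [StarRing S] [Algebra ℂ S]

/-- The homomorphism on the free `*`-algebra sending `a` to `u` and `a*` to `u*`. -/
def freeLift (u : S) : FreeStar →ₐ[ℂ] S :=
  (FreeAlgebra.lift ℂ fun b : Bool => cond b (star u) u : FreeAlgebra ℂ Bool →ₐ[ℂ] S)

theorem freeLift_letter (u : S) (b : Bool) :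
    freeLift u (FreeStar.letter b) = cond b (star u) u :=
  FreeAlgebra.lift_ι_apply (R := ℂ) (fun b : Bool => cond b (star u) u) b

/-- The algebra homomorphism determined by an element `u` with `u* u + u u* = 1`. -/
def liftAlgHom (u : S) (hu : star u * u + u * star u = 1) : Poly →ₐ[ℂ] S :=
  RingQuot.liftAlgHom ℂ ⟨freeLift u, by
    rintro _ _ ⟨⟩
    rw [FreeStar.a, FreeStar.star_letter, map_add, map_mul, map_mul, freeLift_letter,
      freeLift_letter, map_one]
    exact hu⟩

theorem liftAlgHom_mk_letter (u : S) (hu : star u * u + u * star u = 1) (b : Bool) :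
    liftAlgHom u hu (mk (FreeStar.letter b)) = cond b (star u) u :=
  (RingQuot.liftAlgHom_mkAlgHom_apply ℂ _ _ _).trans (freeLift_letter u b)

theorem liftAlgHom_gen (u : S) (hu : star u * u + u * star u = 1) :
    liftAlgHom u hu gen = u := liftAlgHom_mk_letter u hu false

theorem liftAlgHom_star_gen (u : S) (hu : star u * u + u * star u = 1) :
    liftAlgHom u hu (star gen) = star u := by
  rw [gen, star_mk, FreeStar.a, FreeStar.star_letter]
  exact liftAlgHom_mk_letter u hu true

theorem starAlgHom_ext {f g : Poly →⋆ₐ[ℂ] S} (h : f gen = g gen) : f = g := by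
  ext x
  induction x using induction_gen with
  | algebraMap c => rw [AlgHomClass.commutes, AlgHomClass.commutes]
  | gen => exact h
  | star_gen => rw [map_star, map_star, h]
  | mul x y hx hy => rw [map_mul, map_mul, hx, hy]
  | add x y hx hy => rw [map_add, map_add, hx, hy]

variable [StarModule ℂ S]

/-- The universal property of `ℂ⟨a, a* | a* a + a a* = 1⟩`. -/
def lift (u : S) (hu : star u * u + u * star u = 1) : Poly →⋆ₐ[ℂ] S where
  __ := liftAlgHom u hu
  map_star' x := by
    change liftAlgHom u hu (star x) = star (liftAlgHom u hu x)
    induction x using induction_gen with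
    | algebraMap c =>
      rw [← algebraMap_star_comm c, AlgHom.commutes, AlgHom.commutes, algebraMap_star_comm]
    | gen => rw [liftAlgHom_star_gen, liftAlgHom_gen]
    | star_gen => rw [star_star, liftAlgHom_star_gen, liftAlgHom_gen, star_star]
    | mul x y hx hy => rw [star_mul, map_mul, hx, hy, map_mul, star_mul]
    | add x y hx hy => rw [star_add, map_add, hx, hy, map_add, star_add]

theorem lift_gen (u : S) (hu : star u * u + u * star u = 1) : lift u hu gen = u :=
  liftAlgHom_gen u hu

end Lift

/-! ### The trace of the `*`-algebra -/

theorem star_gen_mul_gen : star gen * gen = 1 - gen * star gen :=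
  eq_sub_of_add_eq gen_rel

theorem gen_sq_comm (x : Poly) : x * (gen * gen) = gen * gen * x := by
  induction x using induction_gen with
  | algebraMap c => exact Algebra.commutes c _
  | gen => rw [mul_assoc]
  | star_gen =>
    rw [← mul_assoc, star_gen_mul_gen, sub_mul, mul_assoc gen, star_gen_mul_gen]
    noncomm_ring
  | mul x y hx hy => rw [mul_assoc, hy, ← mul_assoc, hx, mul_assoc]
  | add x y hx hy => rw [add_mul, mul_add, hx, hy]

theorem star_gen_sq_comm (x : Poly) :
    x * (star gen * star gen) = star gen * star gen * x := by
  have h := congrArg star (gen_sq_comm (star x))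
  simp only [star_mul, star_star] at h
  exact h.symm

/-- The central subalgebra generated by `a²` and `a*²`. -/
def central : Subalgebra ℂ Poly :=
  Algebra.adjoin ℂ {gen * gen, star gen * star gen}

theorem gen_sq_mem_central : gen * gen ∈ central := Algebra.subset_adjoin (by simp)

theorem star_gen_sq_mem_central : star gen * star gen ∈ central :=
  Algebra.subset_adjoin (by simp)

theorem central_le_center : central ≤ Subalgebra.center ℂ Poly := by
  refine Algebra.adjoin_le ?_
  rintro _ (rfl | rfl) <;> rw [SetLike.mem_coe, Subalgebra.mem_center_iff]
  · exact gen_sq_comm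
  · exact star_gen_sq_comm

theorem mul_comm_of_mem_central {c : Poly} (hc : c ∈ central) (x : Poly) : x * c = c * x :=
  Subalgebra.mem_center_iff.mp (central_le_center hc) x

/-- The algebra is spanned by `1, a, a*, a a*` over the central subalgebra. -/
theorem exists_central_coeff (x : Poly) : ∃ c₀ ∈ central, ∃ c₁ ∈ central, ∃ c₂ ∈ central,
    ∃ c₃ ∈ central, x = c₀ + c₁ * gen + c₂ * star gen + c₃ * (gen * star gen) := by
  let S : Set Poly := {x | ∃ c₀ ∈ central, ∃ c₁ ∈ central, ∃ c₂ ∈ central,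
    ∃ c₃ ∈ central, x = c₀ + c₁ * gen + c₂ * star gen + c₃ * (gen * star gen)}
  suffices h : ∀ x, ∀ s ∈ S, x * s ∈ S by
    have := h x 1 ⟨1, one_mem _, 0, zero_mem _, 0, zero_mem _, 0, zero_mem _, by simp⟩
    rwa [mul_one] at this
  intro x
  induction x using induction_gen with
  | algebraMap c =>
    rintro _ ⟨c₀, h₀, c₁, h₁, c₂, h₂, c₃, h₃, rfl⟩
    have hc := central.algebraMap_mem c
    refine ⟨_, mul_mem hc h₀, _, mul_mem hc h₁, _, mul_mem hc h₂, _, mul_mem hc h₃, ?_⟩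
    noncomm_ring
  | gen =>
    rintro _ ⟨c₀, h₀, c₁, h₁, c₂, h₂, c₃, h₃, rfl⟩
    refine ⟨_, mul_mem h₁ gen_sq_mem_central, _, h₀, _, mul_mem h₃ gen_sq_mem_central, _, h₂, ?_⟩
    simp only [mul_add, ← mul_assoc, mul_comm_of_mem_central h₀, mul_comm_of_mem_central h₁,
      mul_comm_of_mem_central h₂, mul_comm_of_mem_central h₃]
    abel
  | star_gen =>
    rintro _ ⟨c₀, h₀, c₁, h₁, c₂, h₂, c₃, h₃, rfl⟩
    refine ⟨_, add_mem h₁ (mul_mem h₂ star_gen_sq_mem_central), _,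
      neg_mem (mul_mem h₃ star_gen_sq_mem_central), _, add_mem h₀ h₃, _, neg_mem h₁, ?_⟩
    have e : star gen * (gen * star gen) = star gen - star gen * star gen * gen := by
      rw [← mul_assoc, star_gen_mul_gen, sub_mul, one_mul, mul_assoc, star_gen_sq_comm]
    simp only [mul_add]
    rw [mul_comm_of_mem_central h₀, ← mul_assoc, ← mul_assoc _ c₂, ← mul_assoc _ c₃,
      mul_comm_of_mem_central h₁, mul_comm_of_mem_central h₂, mul_comm_of_mem_central h₃,
      mul_assoc c₁, mul_assoc c₃, e, star_gen_mul_gen]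
    noncomm_ring
  | mul x y hx hy => intro s hs; rw [mul_assoc]; exact hx _ (hy _ hs)
  | add x y hx hy =>
    intro s hs
    rw [add_mul]
    obtain ⟨c₀, h₀, c₁, h₁, c₂, h₂, c₃, h₃, hc⟩ := hx s hs
    obtain ⟨d₀, k₀, d₁, k₁, d₂, k₂, d₃, k₃, hd⟩ := hy s hs
    refine ⟨_, add_mem h₀ k₀, _, add_mem h₁ k₁, _, add_mem h₂ k₂, _, add_mem h₃ k₃, ?_⟩
    rw [hc, hd]
    noncomm_ring

/-- The anti-automorphism sending `a` to `-a` and `a*` to `-a*`, as a homomorphism to the opposite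
algebra. -/
def adjHom : Poly →⋆ₐ[ℂ] Polyᵐᵒᵖ :=
  lift (MulOpposite.op (-gen)) (by
    rw [← MulOpposite.op_star, ← MulOpposite.op_mul, ← MulOpposite.op_mul, ← MulOpposite.op_add,
      star_neg, neg_mul_neg, neg_mul_neg, add_comm, gen_rel, MulOpposite.op_one])

/-- The adjugate: in a representation by `2 × 2` matrices in which `a` is traceless it becomes the
adjugate of a matrix. -/
def adj (x : Poly) : Poly := (adjHom x).unop

theorem adj_algebraMap (c : ℂ) : adj (algebraMap ℂ Poly c) = algebraMap ℂ Poly c := by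
  rw [adj, AlgHomClass.commutes]; rfl

theorem adj_gen : adj gen = -gen := congrArg MulOpposite.unop (lift_gen _ _)

theorem adj_mul (x y : Poly) : adj (x * y) = adj y * adj x := by simp [adj]

theorem adj_add (x y : Poly) : adj (x + y) = adj x + adj y := by simp [adj]

theorem adj_star (x : Poly) : adj (star x) = star (adj x) := by simp [adj, map_star]

theorem adj_of_mem_central {c : Poly} (hc : c ∈ central) : adj c = c := by
  induction hc using Algebra.adjoin_induction with
  | mem x hx =>
    obtain rfl | rfl := hx
    · rw [adj_mul, adj_gen, neg_mul_neg]
    · rw [adj_mul, adj_star, adj_gen, star_neg, neg_mul_neg]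
  | algebraMap c => exact adj_algebraMap c
  | add x y _ _ hx hy => rw [adj_add, hx, hy]
  | mul x y hx _ hx' hy' => rw [adj_mul, hx', hy', mul_comm_of_mem_central hx]

/-- The trace `x + adj x` is central, because `a` and `a*` are traceless and
`a a* + adj (a a*) = a a* + a* a = 1`. -/
theorem add_adj_mem_central (x : Poly) : x + adj x ∈ central := by
  obtain ⟨c₀, h₀, c₁, h₁, c₂, h₂, c₃, h₃, rfl⟩ := exists_central_coeff x
  simp only [adj_add, adj_mul, adj_star, adj_gen, adj_of_mem_central h₀, adj_of_mem_central h₁,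
    adj_of_mem_central h₂, adj_of_mem_central h₃, star_neg, neg_mul_neg, star_gen_mul_gen]
  rw [neg_mul, neg_mul, mul_comm_of_mem_central h₁, mul_comm_of_mem_central h₂,
    mul_comm_of_mem_central h₃]
  convert add_mem (add_mem h₀ h₀) h₃ using 1
  noncomm_ring

end Poly

/-! ### Matrix-valued functions -/

theorem evalAt_sub (f g : FunAlg) (x : HalfInterval) (z : Circle) :
    evalAt (f - g) x z = evalAt f x z - evalAt g x z := rfl

theorem evalAt_smul (c : ℂ) (f : FunAlg) (x : HalfInterval) (z : Circle) :
    evalAt (c • f) x z = c • evalAt f x z := rfl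

theorem FunAlg.ext_evalAt {f g : FunAlg} (h : ∀ x z, evalAt f x z = evalAt g x z) : f = g := by
  refine ContinuousMap.ext fun x => CStarMatrix.ext fun i j => ContinuousMap.ext fun z => ?_
  exact congrFun (congrFun (h x z) i) j

/-- Evaluation at a point, as a representation by `2 × 2` matrices. -/
def evalHom (x : HalfInterval) (z : Circle) : FunAlg →⋆ₐ[ℂ] Matrix (Fin 2) (Fin 2) ℂ where
  toFun f := evalAt f x z
  map_one' := by simpa using evalAt_algebraMap 1 x z
  map_mul' f g := evalAt_mul f g x z
  map_zero' := rfl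
  map_add' f g := evalAt_add f g x z
  commutes' c := evalAt_algebraMap c x z
  map_star' f := evalAt_star f x z

theorem evalHom_apply (x : HalfInterval) (z : Circle) (f : FunAlg) :
    evalHom x z f = evalAt f x z := rfl

theorem evalAt_sum {ι : Type*} (s : Finset ι) (f : ι → FunAlg) (x : HalfInterval) (z : Circle) :
    evalAt (∑ i ∈ s, f i) x z = ∑ i ∈ s, evalAt (f i) x z :=
  map_sum (evalHom x z) f s

theorem norm_evalAt_apply_le (f : FunAlg) (x : HalfInterval) (z : Circle) (i j : Fin 2) :
    ‖evalAt f x z i j‖ ≤ ‖f‖ := by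
  calc ‖evalAt f x z i j‖ ≤ ‖(f x).entry i j‖ := ContinuousMap.norm_coe_le_norm _ z
    _ ≤ ‖f x‖ := CStarMatrix.norm_entry_le_norm
    _ ≤ ‖f‖ := ContinuousMap.norm_coe_le_norm f x

/-- The norm of a matrix-valued function is controlled by the suprema of its entries. -/
theorem exists_norm_le_of_norm_evalAt_apply_le : ∃ C : ℝ, 0 ≤ C ∧ ∀ (f : FunAlg) (r : ℝ), 0 ≤ r →
    (∀ x z i j, ‖evalAt f x z i j‖ ≤ r) → ‖f‖ ≤ C * r := by
  let L : (Fin 2 → Fin 2 → C(Circle, ℂ)) →L[ℂ] CStarMatrix (Fin 2) (Fin 2) C(Circle, ℂ) :=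
    (CStarMatrix.ofMatrixL :
      Matrix (Fin 2) (Fin 2) C(Circle, ℂ) ≃L[ℂ] _).toContinuousLinearMap
  refine ⟨‖L‖, L.opNorm_nonneg, fun f r hr h => ?_⟩
  refine (ContinuousMap.norm_le _ (by positivity)).2 fun x => ?_
  refine (L.le_opNorm fun i j => (f x).entry i j).trans ?_
  gcongr
  refine (pi_norm_le_iff_of_nonneg hr).2 fun i => (pi_norm_le_iff_of_nonneg hr).2 fun j =>
    (ContinuousMap.norm_le _ hr).2 fun z => h x z i j

theorem continuous_evalAt_apply (f : FunAlg) (i j : Fin 2) :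
    Continuous fun p : HalfInterval × Circle => evalAt f p.1 p.2 i j := by
  have h : Continuous fun M : MatCT => M.entry i j := by
    refine LipschitzWith.continuous (K := 1) (LipschitzWith.of_dist_le_mul fun M N => ?_)
    rw [dist_eq_norm, dist_eq_norm, NNReal.coe_one, one_mul]
    exact CStarMatrix.norm_entry_le_norm (M := (M - N : MatCT))
  exact continuous_eval.comp ((h.comp (f.continuous.comp continuous_fst)).prodMk continuous_snd)

theorem continuous_evalAt_left (x : HalfInterval) (z : Circle) :
    Continuous fun f : FunAlg => evalAt f x z := by
  refine continuous_matrix fun i j => ?_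
  refine LipschitzWith.continuous (K := 1) (LipschitzWith.of_dist_le_mul fun f g => ?_)
  rw [dist_eq_norm, dist_eq_norm, NNReal.coe_one, one_mul]
  exact norm_evalAt_apply_le (f - g) x z i j

/-- The matrix-valued function with given entries. -/
def ofEntries (G : Fin 2 → Fin 2 → C(HalfInterval × Circle, ℂ)) : FunAlg where
  toFun x := show CStarMatrix (Fin 2) (Fin 2) C(Circle, ℂ) from
    CStarMatrix.ofMatrix fun i j => (G i j).curry x
  continuous_toFun := by
    have h : Continuous fun x => (fun i j => (G i j).curry x : Matrix (Fin 2) (Fin 2) _) :=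
      continuous_matrix fun i j => (G i j).curry.continuous
    exact CStarMatrix.ofMatrixL.continuous.comp h

theorem evalAt_ofEntries (G : Fin 2 → Fin 2 → C(HalfInterval × Circle, ℂ)) (x : HalfInterval)
    (z : Circle) : evalAt (ofEntries G) x z = Matrix.of fun i j => G i j (x, z) := rfl

/-- `B` is closed: its conditions are equations between values at points, the diagonality of
`V* f(1/2) V` included. -/
theorem isClosed_B : IsClosed (B : Set FunAlg) := by
  have hc := continuous_evalAt_left
  have h : (B : Set FunAlg) =
      {f | ∀ x : HalfInterval, 0 < (x : ℝ) → (x : ℝ) < 1 / 2 → ∀ z,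
        evalAt f x z = W (-1) * evalAt f x (-z) * (W (-1))ᴴ} ∩
      {f | ∀ z, evalAt f leftEnd z = W z * evalAt f leftEnd 1 * (W z)ᴴ} ∩
      {f | ∀ z, (Vᴴ * evalAt f rightEnd z * V) 0 1 = 0 ∧
        (Vᴴ * evalAt f rightEnd z * V) 1 0 = 0} ∩
      {f | ∀ z, evalAt f rightEnd z = W (-1) * evalAt f rightEnd (-z) * (W (-1))ᴴ} := by
    ext f
    refine ⟨fun hf => ⟨⟨⟨hf.symm_interior, hf.conj_left⟩, fun z => ?_⟩, hf.symm_right⟩,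
      fun ⟨⟨⟨h1, h2⟩, h3⟩, h4⟩ => ⟨h1, h2, ?_, h4⟩⟩
    · obtain ⟨d, hd⟩ := hf.diag_right
      have : Vᴴ * evalAt f rightEnd z * V = Matrix.diagonal fun i => d i z := by
        rw [hd]
        calc _ = (Vᴴ * V) * Matrix.diagonal (fun i => d i z) * (Vᴴ * V) := by noncomm_ring
          _ = _ := by rw [V_star_mul, one_mul, mul_one]
      rw [this]
      simp
    · have hcont (i : Fin 2) : Continuous fun z => (Vᴴ * evalAt f rightEnd z * V) i i := by
        have : Continuous fun z => evalAt f rightEnd z := continuous_matrix fun i j =>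
          (continuous_evalAt_apply f i j).comp (Continuous.prodMk_right rightEnd)
        exact ((continuous_const.matrix_mul this).matrix_mul continuous_const).matrix_elem i i
      refine ⟨fun i => ⟨_, hcont i⟩, fun z => ?_⟩
      have : Matrix.diagonal (fun i => (Vᴴ * evalAt f rightEnd z * V) i i) =
          Vᴴ * evalAt f rightEnd z * V := by
        ext i j
        fin_cases i <;> fin_cases j
        · rfl
        · exact (h3 z).1.symm
        · exact (h3 z).2.symm
        · rfl
      change _ = V * Matrix.diagonal (fun i => (Vᴴ * evalAt f rightEnd z * V) i i) * Vᴴ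
      rw [this]
      calc _ = (V * Vᴴ) * evalAt f rightEnd z * (V * Vᴴ) := by rw [V_mul_star, one_mul, mul_one]
        _ = _ := by noncomm_ring
  rw [h]
  simp only [Set.ofPred_forall, Set.ofPred_and]
  have hW (U : Matrix (Fin 2) (Fin 2) ℂ) (x : HalfInterval) (z : Circle) :
      Continuous fun f => U * evalAt f x z * Uᴴ :=
    (continuous_const.matrix_mul (hc x z)).matrix_mul continuous_const
  have hV (z : Circle) : Continuous fun f => Vᴴ * evalAt f rightEnd z * V :=
    (continuous_const.matrix_mul (hc rightEnd z)).matrix_mul continuous_const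
  refine (((isClosed_iInter fun x => isClosed_iInter fun _ => isClosed_iInter fun _ =>
    isClosed_iInter fun z => isClosed_eq (hc x z) (hW _ x _)).inter
    (isClosed_iInter fun z => isClosed_eq (hc _ z) (hW _ _ _))).inter
    (isClosed_iInter fun z => ?_)).inter
    (isClosed_iInter fun z => isClosed_eq (hc _ z) (hW _ _ _))
  exact (isClosed_eq ((hV z).matrix_elem 0 1) continuous_const).inter
    (isClosed_eq ((hV z).matrix_elem 1 0) continuous_const)

/-! ### The homomorphism from `CAR₁` to matrix-valued functions -/

/-- The function `(x, z) ↦ z (0 √x; √(1-x) 0)`. -/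
def genFun : FunAlg :=
  ofEntries ![![0, ⟨fun p => (p.2 : ℂ) * ((√(p.1 : ℝ) : ℝ) : ℂ), by fun_prop⟩],
    ![⟨fun p => (p.2 : ℂ) * ((√(1 - (p.1 : ℝ)) : ℝ) : ℂ), by fun_prop⟩, 0]]

theorem evalAt_genFun (x : HalfInterval) (z : Circle) : evalAt genFun x z =
    (z : ℂ) • !![0, ((√(x : ℝ) : ℝ) : ℂ); ((√(1 - (x : ℝ)) : ℝ) : ℂ), 0] := by
  rw [genFun, evalAt_ofEntries]
  ext i j
  fin_cases i <;> fin_cases j <;> simp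

theorem evalAt_star_genFun (x : HalfInterval) (z : Circle) : evalAt (star genFun) x z =
    (star (z : ℂ)) • !![0, ((√(1 - (x : ℝ)) : ℝ) : ℂ); ((√(x : ℝ) : ℝ) : ℂ), 0] := by
  rw [evalAt_star, evalAt_genFun, Matrix.conjTranspose_smul]
  congr 1
  ext i j
  fin_cases i <;> fin_cases j <;> simp

theorem Circle.star_coe_mul_coe (z : Circle) : star (z : ℂ) * (z : ℂ) = 1 := by
  rw [RCLike.star_def, ← Circle.coe_inv_eq_conj, ← Circle.coe_mul, inv_mul_cancel,
    Circle.coe_one]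

theorem Circle.coe_mul_star_coe (z : Circle) : (z : ℂ) * star (z : ℂ) = 1 := by
  rw [mul_comm, Circle.star_coe_mul_coe]

theorem HalfInterval.sqrt_mul_sqrt (x : HalfInterval) :
    ((√(x : ℝ) : ℝ) : ℂ) * ((√(x : ℝ) : ℝ) : ℂ) = ((x : ℝ) : ℂ) := by
  rw [← Complex.ofReal_mul, Real.mul_self_sqrt x.2.1]

theorem HalfInterval.sqrt_one_sub_mul_sqrt_one_sub (x : HalfInterval) :
    ((√(1 - (x : ℝ)) : ℝ) : ℂ) * ((√(1 - (x : ℝ)) : ℝ) : ℂ) = 1 - ((x : ℝ) : ℂ) := by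
  have hx := x.2.2
  rw [← Complex.ofReal_mul, Real.mul_self_sqrt (by linarith), Complex.ofReal_sub,
    Complex.ofReal_one]

theorem evalAt_genFun_mul_star (x : HalfInterval) (z : Circle) :
    evalAt (genFun * star genFun) x z = !![((x : ℝ) : ℂ), 0; 0, 1 - ((x : ℝ) : ℂ)] := by
  rw [evalAt_mul, evalAt_genFun, evalAt_star_genFun, Matrix.smul_mul, Matrix.mul_smul, smul_smul,
    Circle.coe_mul_star_coe, one_smul]
  ext i j
  fin_cases i <;> fin_cases j <;>
    simp [Matrix.mul_apply, x.sqrt_mul_sqrt, x.sqrt_one_sub_mul_sqrt_one_sub]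

theorem evalAt_star_genFun_mul (x : HalfInterval) (z : Circle) :
    evalAt (star genFun * genFun) x z = !![1 - ((x : ℝ) : ℂ), 0; 0, ((x : ℝ) : ℂ)] := by
  rw [evalAt_mul, evalAt_genFun, evalAt_star_genFun, Matrix.smul_mul, Matrix.mul_smul, smul_smul,
    Circle.star_coe_mul_coe, one_smul]
  ext i j
  fin_cases i <;> fin_cases j <;>
    simp [Matrix.mul_apply, x.sqrt_mul_sqrt, x.sqrt_one_sub_mul_sqrt_one_sub]

theorem genFun_rel : star genFun * genFun + genFun * star genFun = 1 := by
  refine FunAlg.ext_evalAt fun x z => ?_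
  rw [evalAt_add, evalAt_star_genFun_mul, evalAt_genFun_mul_star, ← evalHom_apply x z 1, map_one]
  ext i j
  fin_cases i <;> fin_cases j <;> simp

/-- The homomorphism to matrix-valued functions, before completion. -/
def polyHom : Poly →⋆ₐ[ℂ] FunAlg := Poly.lift genFun genFun_rel

theorem polyHom_gen : polyHom Poly.gen = genFun := Poly.lift_gen _ _

/-- Evaluation at a point is a representation on `ℂ²`, so the universal seminorm dominates every
matrix entry. -/
theorem norm_evalAt_polyHom_apply_le (b : Poly) (x : HalfInterval) (z : Circle) (i j : Fin 2) :
    ‖evalAt (polyHom b) x z i j‖ ≤ ‖b‖ := by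
  let π : Poly →⋆ₐ[ℂ] (EuclideanSpace ℂ (Fin 2) →L[ℂ] EuclideanSpace ℂ (Fin 2)) :=
    (Matrix.toEuclideanCLM (n := Fin 2) (𝕜 := ℂ) : Matrix (Fin 2) (Fin 2) ℂ →⋆ₐ[ℂ] _).comp
      ((evalHom x z).comp polyHom)
  have h : π b (EuclideanSpace.single j 1) i = evalAt (polyHom b) x z i j := by
    change (Matrix.mulVec (evalAt (polyHom b) x z) (Pi.single j 1)) i = _
    simp
  rw [← h]
  calc ‖π b (EuclideanSpace.single j 1) i‖ ≤ ‖π b (EuclideanSpace.single j 1)‖ :=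
        PiLp.norm_apply_le _ i
    _ ≤ ‖π b‖ * ‖(EuclideanSpace.single j 1 : EuclideanSpace ℂ (Fin 2))‖ := (π b).le_opNorm _
    _ = ‖π b‖ := by simp
    _ ≤ ‖b‖ := Poly.norm_map_le π b

theorem uniformContinuous_polyHom : UniformContinuous polyHom := by
  obtain ⟨C, hC, h⟩ := exists_norm_le_of_norm_evalAt_apply_le
  refine (LipschitzWith.of_dist_le_mul (K := ⟨C, hC⟩) fun x y => ?_).uniformContinuous
  rw [dist_eq_norm, dist_eq_norm, ← map_sub]
  exact h _ _ (norm_nonneg _) (norm_evalAt_polyHom_apply_le _)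

namespace CAR₁

/-- The canonical map to the completion, as a `*`-homomorphism. -/
def ofHom : Poly →⋆ₐ[ℂ] CAR₁ where
  toFun := of
  map_one' := rfl
  map_mul' := of_mul
  map_zero' := rfl
  map_add' := of_add
  commutes' c := by
    change of (algebraMap ℂ Poly c) = algebraMap ℂ CAR₁ c
    rw [Algebra.algebraMap_eq_smul_one, Algebra.algebraMap_eq_smul_one, of_smul]
    rfl
  map_star' x := (star_of x).symm

theorem ofHom_apply (x : Poly) : ofHom x = of x := rfl

/-- The extension of a uniformly continuous function to the completion. -/
def extendFun (φ : Poly → FunAlg) : CAR₁ → FunAlg := UniformSpace.Completion.extension φ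

theorem extendFun_of {φ : Poly → FunAlg} (hφ : UniformContinuous φ) (x : Poly) :
    extendFun φ (of x) = φ x := UniformSpace.Completion.extension_coe hφ x

theorem continuous_extendFun (φ : Poly → FunAlg) : Continuous (extendFun φ) :=
  UniformSpace.Completion.continuous_extension

/-- The extension of a uniformly continuous `*`-homomorphism to the completion. -/
def extend (φ : Poly →⋆ₐ[ℂ] FunAlg) (hφ : UniformContinuous φ) : CAR₁ →⋆ₐ[ℂ] FunAlg :=
  have hof := extendFun_of hφ
  have hc := continuous_extendFun φ
  { toFun := extendFun φ
    map_one' := (hof 1).trans (map_one φ)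
    map_mul' := fun x y => by
      refine denseRange_of.induction_on₂ (p := fun x y => extendFun φ (x * y) =
        extendFun φ x * extendFun φ y) (isClosed_eq (hc.comp continuous_mul)
        ((hc.comp continuous_fst).mul (hc.comp continuous_snd))) (fun x y => ?_) x y
      rw [← of_mul, hof, hof, hof, map_mul]
    map_zero' := (hof 0).trans (map_zero φ)
    map_add' := fun x y => by
      refine denseRange_of.induction_on₂ (p := fun x y => extendFun φ (x + y) =
        extendFun φ x + extendFun φ y) (isClosed_eq (hc.comp continuous_add)
        ((hc.comp continuous_fst).add (hc.comp continuous_snd))) (fun x y => ?_) x y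
      rw [← of_add, hof, hof, hof, map_add]
    commutes' := fun c => by
      rw [← AlgHomClass.commutes ofHom c, ofHom_apply, hof, AlgHomClass.commutes]
    map_star' := fun x => by
      refine denseRange_of.induction_on (p := fun x => extendFun φ (star x) =
        star (extendFun φ x)) x (isClosed_eq (hc.comp continuous_star') hc.star) fun x => ?_
      rw [star_of, hof, hof, map_star] }

theorem extend_of (φ : Poly →⋆ₐ[ℂ] FunAlg) (hφ : UniformContinuous φ) (x : Poly) :
    extend φ hφ (of x) = φ x := extendFun_of hφ x

theorem starAlgHom_ext {A : Type*} [CStarAlgebra A] {f g : CAR₁ →⋆ₐ[ℂ] A} (h : f a = g a) :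
    f = g := by
  have hp : f.comp ofHom = g.comp ofHom := Poly.starAlgHom_ext h
  ext x
  refine denseRange_of.induction_on (p := fun x => f x = g x) x
    (isClosed_eq (map_continuous f) (map_continuous g)) fun x => ?_
  exact DFunLike.congr_fun hp x

end CAR₁

/-- The homomorphism from `CAR₁` to the matrix-valued functions. -/
def carHom : CAR₁ →⋆ₐ[ℂ] FunAlg := CAR₁.extend polyHom uniformContinuous_polyHom

theorem carHom_of (x : Poly) : carHom (CAR₁.of x) = polyHom x := CAR₁.extend_of _ _ x

theorem carHom_a : carHom CAR₁.a = genFun := (carHom_of _).trans polyHom_gen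

theorem continuous_carHom : Continuous carHom := map_continuous carHom

/-! ### The central element `a²` and its functional calculus -/

/-- The scalar by which `a²` acts at the point `(x, z)`. -/
def coord (x : HalfInterval) (z : Circle) : ℂ :=
  (z : ℂ) * (z : ℂ) * ((√(x : ℝ) * √(1 - (x : ℝ)) : ℝ) : ℂ)

theorem continuous_coord : Continuous fun p : HalfInterval × Circle => coord p.1 p.2 := by
  unfold coord
  fun_prop

theorem norm_coord (x : HalfInterval) (z : Circle) :
    ‖coord x z‖ = √(x : ℝ) * √(1 - (x : ℝ)) := by
  rw [coord, norm_mul, norm_mul, Circle.norm_coe, one_mul, one_mul, Complex.norm_real,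
    Real.norm_of_nonneg (by positivity)]

theorem sq_norm_coord (x : HalfInterval) (z : Circle) :
    ‖coord x z‖ ^ 2 = (x : ℝ) * (1 - (x : ℝ)) := by
  have hx := x.2.2
  rw [norm_coord, mul_pow, Real.sq_sqrt x.2.1, Real.sq_sqrt (by linarith)]

theorem norm_coord_le (x : HalfInterval) (z : Circle) : ‖coord x z‖ ≤ 1 / 2 := by
  refine abs_le_of_sq_le_sq' ?_ (by norm_num) |>.2
  rw [sq_norm_coord]
  nlinarith [sq_nonneg ((x : ℝ) - 1 / 2)]

theorem exists_coord_eq {w : ℂ} (hw : ‖w‖ ≤ 1 / 2) : ∃ x z, coord x z = w := by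
  have hr := norm_nonneg w
  have hs : 0 ≤ 1 - 4 * ‖w‖ ^ 2 := by nlinarith
  -- `x` is the smaller root of `x (1 - x) = ‖w‖²`.
  let x : ℝ := (1 - √(1 - 4 * ‖w‖ ^ 2)) / 2
  have hs1 : √(1 - 4 * ‖w‖ ^ 2) ≤ 1 := Real.sqrt_le_one.mpr (by nlinarith)
  have hx0 : 0 ≤ x := by simp only [x]; linarith
  have hx1 : x ≤ 1 / 2 := by
    have := Real.sqrt_nonneg (1 - 4 * ‖w‖ ^ 2)
    simp only [x]; linarith
  have hx : √x * √(1 - x) = ‖w‖ := by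
    rw [← Real.sqrt_mul hx0, Real.sqrt_eq_iff_mul_self_eq (by nlinarith) hr]
    have := Real.mul_self_sqrt hs
    simp only [x]
    nlinarith
  refine ⟨⟨x, hx0, hx1⟩, Circle.exp (Complex.arg w / 2), ?_⟩
  rw [coord, hx, ← Circle.coe_mul, ← Circle.exp_add, add_halves, Circle.coe_exp, mul_comm,
    Complex.norm_mul_exp_arg_mul_I]

theorem evalAt_genFun_sq (x : HalfInterval) (z : Circle) :
    evalAt (genFun * genFun) x z = algebraMap ℂ _ (coord x z) := by
  rw [evalAt_mul, evalAt_genFun, Matrix.smul_mul, Matrix.mul_smul, smul_smul,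
    Algebra.algebraMap_eq_smul_one, coord, mul_smul _ (_ : ℂ) (1 : Matrix _ _ ℂ)]
  congr 1
  ext i j
  fin_cases i <;> fin_cases j <;> simp [Matrix.mul_apply, mul_comm]

namespace CAR₁

theorem star_a : star a = of (star Poly.gen) := star_of _

theorem rel : star a * a + a * star a = 1 := by
  rw [star_a, a, ← of_mul, ← of_mul, ← of_add, Poly.gen_rel]; rfl

theorem star_a_mul_a : star a * a = 1 - a * star a := eq_sub_of_add_eq rel

theorem star_a_sq : star (a * a) = of (star Poly.gen * star Poly.gen) := by
  rw [star_mul, star_a, of_mul]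

theorem isStarNormal_a_sq : IsStarNormal (a * a) := ⟨by
  rw [star_a_sq, a, ← of_mul]
  change of _ * of _ = of _ * of _
  rw [← of_mul, ← of_mul, Poly.gen_sq_comm]⟩

/-- With `k = a a*` one has `a² a*² = k - k² = 1/4 - (k - 1/2)² ≤ 1/4`. -/
theorem norm_a_sq_le : ‖a * a‖ ≤ 1 / 2 := by
  let _ := CStarAlgebra.spectralOrder CAR₁
  have _ := CStarAlgebra.spectralOrderedRing CAR₁
  let d : CAR₁ := a * star a - algebraMap ℂ CAR₁ (1 / 2)
  have hd : star d = d := by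
    simp only [d, star_sub, star_mul, star_star, ← algebraMap_star_comm]
    simp
  have h : a * a * star (a * a) + star d * d = algebraMap ℂ CAR₁ (1 / 4) := by
    rw [hd, star_mul]
    have e1 : a * a * (star a * star a) = a * star a - a * star a * (a * star a) := by
      calc a * a * (star a * star a) = a * (a * star a) * star a := by noncomm_ring
        _ = a * (1 - star a * a) * star a := by rw [star_a_mul_a, sub_sub_cancel]
        _ = _ := by noncomm_ring
    have e2 : algebraMap ℂ CAR₁ (1 / 4) =
        algebraMap ℂ CAR₁ (1 / 2) * algebraMap ℂ CAR₁ (1 / 2) := by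
      rw [← map_mul]; norm_num
    have e3 : algebraMap ℂ CAR₁ (1 / 2) * (a * star a) +
        algebraMap ℂ CAR₁ (1 / 2) * (a * star a) = a * star a := by
      rw [← add_mul, ← map_add]; norm_num
    have e4 := Algebra.commutes (1 / 2 : ℂ) (a * star a)
    simp only [d]
    rw [e1, e2, mul_sub, sub_mul, sub_mul, ← e4]
    nth_rw 1 [← e3]
    abel
  have h1 : a * a * star (a * a) ≤ algebraMap ℝ CAR₁ (1 / 4) := by
    have e : algebraMap ℝ CAR₁ (1 / 4) = algebraMap ℂ CAR₁ (1 / 4) := by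
      rw [IsScalarTower.algebraMap_apply ℝ ℂ CAR₁]; norm_num
    rw [e, ← h]
    exact le_add_of_nonneg_right (star_mul_self_nonneg d)
  have h2 := (CStarAlgebra.norm_le_iff_le_algebraMap (a * a * star (a * a)) (by norm_num)
    (mul_star_self_nonneg _)).2 h1
  rw [CStarRing.norm_self_mul_star] at h2
  nlinarith [norm_nonneg (a * a)]

/-- The functional calculus of `a²` is pointwise composition with `coord`. -/
theorem evalAt_carHom_cfc {f : ℂ → ℂ} (hf : Continuous f) (x : HalfInterval) (z : Circle) :
    evalAt (carHom (cfc f (a * a))) x z = algebraMap ℂ _ (f (coord x z)) := by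
  let ψ : CAR₁ →⋆ₐ[ℂ] CStarMatrix (Fin 2) (Fin 2) ℂ :=
    ((CStarMatrix.ofMatrixStarAlgEquiv : Matrix (Fin 2) (Fin 2) ℂ ≃⋆ₐ[ℂ] _) :
      Matrix (Fin 2) (Fin 2) ℂ →⋆ₐ[ℂ] CStarMatrix (Fin 2) (Fin 2) ℂ).comp
      ((evalHom x z).comp carHom)
  have h1 : ψ (a * a) = algebraMap ℂ _ (coord x z) := by
    change evalAt (carHom (a * a)) x z = _
    rw [map_mul, carHom_a, evalAt_genFun_sq]; rfl
  have h2 : ψ (cfc f (a * a)) = cfc f (ψ (a * a)) :=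
    ψ.map_cfc f (a * a) hf.continuousOn (map_continuous ψ) isStarNormal_a_sq
      (isStarNormal_a_sq.map ψ)
  rw [h1, cfc_algebraMap] at h2
  exact h2

/-! ### The homomorphism is bounded below -/

theorem exists_cfc_eq_of_mem_central {c : Poly} (hc : c ∈ Poly.central) :
    ∃ f : ℂ → ℂ, Continuous f ∧ of c = cfc f (a * a) := by
  have := isStarNormal_a_sq
  induction hc using Algebra.adjoin_induction with
  | mem x hx =>
    obtain rfl | rfl := hx
    · exact ⟨id, continuous_id, by rw [cfc_id ℂ (a * a) this, of_mul]; rfl⟩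
    · exact ⟨fun w => star w, continuous_star, 
      star_a_sq.symm.trans (cfc_star_id (R := ℂ) (a * a) this).symm⟩
  | algebraMap c =>
    exact ⟨fun _ => c, continuous_const, by
      rw [cfc_const c (a * a) this, ← ofHom_apply, AlgHomClass.commutes]⟩
  | add x y _ _ hx hy =>
    obtain ⟨f, hf, hx⟩ := hx
    obtain ⟨g, hg, hy⟩ := hy
    exact ⟨fun w => f w + g w, hf.add hg, by
      rw [of_add, hx, hy, cfc_add (a * a) f g hf.continuousOn hg.continuousOn]⟩
  | mul x y _ _ hx hy =>
    obtain ⟨f, hf, hx⟩ := hx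
    obtain ⟨g, hg, hy⟩ := hy
    exact ⟨fun w => f w * g w, hf.mul hg, by
      rw [of_mul, hx, hy, cfc_mul f g (a * a) hf.continuousOn hg.continuousOn]⟩

end CAR₁

open CAR₁

theorem evalAt_polyHom_adj (y : Poly) (x : HalfInterval) (z : Circle) :
    evalAt (polyHom y.adj) x z = (evalAt (polyHom y) x z).adjugate := by
  induction y using Poly.induction_gen with
  | algebraMap c =>
    rw [Poly.adj_algebraMap, AlgHomClass.commutes, evalAt_algebraMap]
    ext i j
    fin_cases i <;> fin_cases j <;> simp [Matrix.adjugate_fin_two, Matrix.algebraMap_matrix_apply]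
  | gen =>
    rw [Poly.adj_gen, map_neg, polyHom_gen, ← evalHom_apply, map_neg, evalHom_apply, evalAt_genFun]
    ext i j
    fin_cases i <;> fin_cases j <;> simp [Matrix.adjugate_fin_two]
  | star_gen =>
    rw [Poly.adj_star, Poly.adj_gen, star_neg, map_neg, map_star, polyHom_gen, ← evalHom_apply,
      map_neg, evalHom_apply, evalAt_star_genFun]
    ext i j
    fin_cases i <;> fin_cases j <;> simp [Matrix.adjugate_fin_two]
  | mul u v hu hv =>
    rw [Poly.adj_mul, map_mul, evalAt_mul, hu, hv, map_mul, evalAt_mul, Matrix.adjugate_mul_distrib]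
  | add u v hu hv =>
    rw [Poly.adj_add, map_add, evalAt_add, hu, hv, map_add, evalAt_add]
    ext i j
    fin_cases i <;> fin_cases j <;> simp [Matrix.adjugate_fin_two, add_comm]

/-- `b* b` is at most its trace `b* b + adj (b* b)`, since `adj (b* b) = adj b (adj b)*` is
positive. The trace is a continuous function of `a²`, hence determined by its values at the points
`(x, z)`, which are traces of `2 × 2` matrices. -/
theorem sq_norm_le_two_mul (b : Poly) : ‖b‖ ^ 2 ≤ 2 * ‖polyHom b‖ ^ 2 := by
  let _ := CStarAlgebra.spectralOrder CAR₁
  have _ := CStarAlgebra.spectralOrderedRing CAR₁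
  let y := star b * b
  obtain ⟨f, hf, hfy⟩ := exists_cfc_eq_of_mem_central (Poly.add_adj_mem_central y)
  have hle : star (of b) * of b ≤ cfc f (a * a) := by
    have : of y.adj = of b.adj * star (of b.adj) := by
      rw [star_of, ← of_mul, Poly.adj_mul, Poly.adj_star]
    rw [← hfy, of_add, this, of_mul, ← star_of]
    exact le_add_of_nonneg_right (mul_star_self_nonneg _)
  have h1 : ‖b‖ ^ 2 ≤ ‖cfc f (a * a)‖ := by
    rw [← norm_of, sq, ← CStarRing.norm_star_mul_self]
    exact CStarAlgebra.norm_le_norm_of_nonneg_of_le (star_mul_self_nonneg _) hle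
  refine h1.trans (norm_cfc_le (by positivity) fun w hw => ?_)
  -- In the zero algebra the spectrum would be empty.
  have : Nontrivial CAR₁ := by
    by_contra h
    have := not_nontrivial_iff_subsingleton.mp h
    rw [spectrum.of_subsingleton] at hw
    exact hw
  obtain ⟨x, z, rfl⟩ := exists_coord_eq ((spectrum.norm_le_norm_of_mem hw).trans norm_a_sq_le)
  have h2 := congrFun (congrFun (evalAt_carHom_cfc hf x z) 0) 0
  rw [← hfy, carHom_of, map_add, evalAt_add, evalAt_polyHom_adj, Matrix.adjugate_fin_two] at h2
  simp only [Matrix.add_apply, Matrix.of_apply, Matrix.cons_val', Matrix.cons_val_zero,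
    Matrix.algebraMap_matrix_apply, if_true, Algebra.algebraMap_self, RingHom.id_apply] at h2
  have h3 : ‖polyHom y‖ = ‖polyHom b‖ ^ 2 := by
    rw [map_mul, map_star, sq]
    exact CStarRing.norm_star_mul_self
  rw [← h2, ← h3, two_mul]
  exact (norm_add_le _ _).trans
    (add_le_add (norm_evalAt_apply_le _ _ _ _ _) (norm_evalAt_apply_le _ _ _ _ _))

theorem sq_norm_le_two_mul_carHom (b : CAR₁) : ‖b‖ ^ 2 ≤ 2 * ‖carHom b‖ ^ 2 := by
  refine denseRange_of.induction_on (p := fun b => ‖b‖ ^ 2 ≤ 2 * ‖carHom b‖ ^ 2) b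
    (isClosed_le (continuous_norm.pow 2) (continuous_const.mul
      (continuous_carHom.norm.pow 2))) fun b => ?_
  rw [norm_of, carHom_of]
  exact sq_norm_le_two_mul b

theorem antilipschitz_carHom : AntilipschitzWith 2 carHom := by
  refine AddMonoidHomClass.antilipschitz_of_bound carHom fun b => ?_
  refine abs_le_of_sq_le_sq' ?_ (by positivity) |>.2
  have := sq_norm_le_two_mul_carHom b
  rw [mul_pow, NNReal.coe_ofNat]
  nlinarith [sq_nonneg ‖carHom b‖]

/-! ### The range lies in `B` -/

theorem V_mul_diagonal_mul_star (d : Fin 2 → ℂ) : V * Matrix.diagonal d * Vᴴ =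
    !![(d 0 + d 1) / 2, (d 0 - d 1) / 2; (d 0 - d 1) / 2, (d 0 + d 1) / 2] := by
  have h : ((√2 : ℝ) : ℂ)⁻¹ * ((√2 : ℝ) : ℂ)⁻¹ = 1 / 2 := by
    rw [← mul_inv, ← Complex.ofReal_mul, Real.mul_self_sqrt (by norm_num)]; norm_num
  have hd : Matrix.diagonal d = !![d 0, 0; 0, d 1] := by
    ext i j
    fin_cases i <;> fin_cases j <;> simp
  rw [hd]
  ext i j
  fin_cases i <;> fin_cases j <;> simp [V, Matrix.mul_apply]
  · linear_combination (d 0 + d 1) * h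
  · linear_combination (d 0 - d 1) * h
  · linear_combination (d 0 - d 1) * h
  · linear_combination (d 0 + d 1) * h

theorem genFun_mem_B : genFun ∈ B := by
  have hsymm (x : HalfInterval) (z : Circle) :
      evalAt genFun x z = W (-1) * evalAt genFun x (-z) * (W (-1))ᴴ := by
    rw [evalAt_genFun, evalAt_genFun]
    ext i j
    fin_cases i <;> fin_cases j <;> simp [W, Matrix.mul_apply]
  refine ⟨fun x _ _ z => hsymm x z, fun z => ?_, ?_, fun z => hsymm _ z⟩
  · rw [evalAt_genFun, evalAt_genFun]
    ext i j
    fin_cases i <;> fin_cases j <;> simp [W, Matrix.mul_apply, leftEnd]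
  · refine ⟨![⟨fun z => (z : ℂ) * ((√(1 / 2) : ℝ) : ℂ), by fun_prop⟩,
      ⟨fun z => -((z : ℂ) * ((√(1 / 2) : ℝ) : ℂ)), by fun_prop⟩], fun z => ?_⟩
    rw [evalAt_genFun, V_mul_diagonal_mul_star]
    have h : (1 : ℝ) - 1 / 2 = 1 / 2 := by norm_num
    simp only [rightEnd, h]
    ext i j
    fin_cases i <;> fin_cases j <;> simp

theorem polyHom_mem_B (b : Poly) : polyHom b ∈ B := by
  induction b using Poly.induction_gen with
  | algebraMap c => rw [AlgHomClass.commutes]; exact B.algebraMap_mem c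
  | gen => rw [polyHom_gen]; exact genFun_mem_B
  | star_gen => rw [map_star, polyHom_gen]; exact star_mem genFun_mem_B
  | mul x y hx hy => rw [map_mul]; exact mul_mem hx hy
  | add x y hx hy => rw [map_add]; exact add_mem hx hy

theorem carHom_mem_B (b : CAR₁) : carHom b ∈ B := by
  refine CAR₁.denseRange_of.induction_on (p := fun b => carHom b ∈ B) b
    (isClosed_B.preimage continuous_carHom) fun b => ?_
  rw [carHom_of]
  exact polyHom_mem_B b

/-! ### The range is all of `B` -/

theorem MemB.symm {G : FunAlg} (hG : MemB G) {x : HalfInterval} (hx : 0 < (x : ℝ)) (z : Circle) :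
    evalAt G x z = W (-1) * evalAt G x (-z) * (W (-1))ᴴ := by
  obtain h | h := lt_or_eq_of_le x.2.2
  · exact hG.symm_interior x hx h z
  · obtain rfl : x = rightEnd := Subtype.ext h
    exact hG.symm_right z

theorem MemB.exists_evalAt_rightEnd {G : FunAlg} (hG : MemB G) (z : Circle) :
    ∃ α β : ℂ, evalAt G rightEnd z = !![α, β; β, α] := by
  obtain ⟨d, hd⟩ := hG.diag_right
  exact ⟨_, _, (hd z).trans (V_mul_diagonal_mul_star _)⟩

/-- A function in `B` vanishing at one point of a fibre of `coord` vanishes on the whole fibre: the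
fibre of `0` is `{0} × 𝕋`, every other fibre is of the form `{(x, z), (x, -z)}`. -/
theorem MemB.evalAt_eq_zero {G : FunAlg} (hG : MemB G) {x₀ x : HalfInterval} {z₀ z : Circle}
    (h : coord x z = coord x₀ z₀) (h₀ : evalAt G x₀ z₀ = 0) : evalAt G x z = 0 := by
  have hx : x = x₀ := by
    have h1 : (x : ℝ) * (1 - x) = x₀ * (1 - x₀) := by
      rw [← sq_norm_coord x z, h, sq_norm_coord]
    have h2 : ((x : ℝ) - x₀) * (1 - x - x₀) = 0 := by linear_combination h1
    have h3 := x.2.2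
    have h4 := x₀.2.2
    refine Subtype.ext ?_
    obtain h5 | h5 := mul_eq_zero.mp h2 <;> linarith
  subst hx
  obtain h0 | h0 := lt_or_eq_of_le x.2.1
  · have hx1 := x.2.2
    have hs : (((√(x : ℝ) * √(1 - (x : ℝ)) : ℝ)) : ℂ) ≠ 0 := by
      have : 0 < √(x : ℝ) * √(1 - (x : ℝ)) :=
        mul_pos (Real.sqrt_pos.mpr h0) (Real.sqrt_pos.mpr (by linarith))
      exact_mod_cast this.ne'
    have hz := mul_self_eq_mul_self_iff.mp (mul_right_cancel₀ hs h)
    obtain hz | hz := hz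
    · rwa [Circle.ext hz]
    · have : z = -z₀ := Circle.ext hz
      rw [hG.symm h0, this, neg_neg, h₀, mul_zero, zero_mul]
  · obtain rfl : x = leftEnd := Subtype.ext h0.symm
    have h1 : evalAt G leftEnd 1 = 0 := by
      calc evalAt G leftEnd 1 = (W z₀)ᴴ * W z₀ * evalAt G leftEnd 1 * ((W z₀)ᴴ * W z₀) := by
            rw [W_star_mul, one_mul, mul_one]
        _ = (W z₀)ᴴ * (W z₀ * evalAt G leftEnd 1 * (W z₀)ᴴ) * W z₀ := by noncomm_ring
        _ = 0 := by rw [← hG.conj_left z₀, h₀, mul_zero, zero_mul]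
    rw [hG.conj_left z, h1, mul_zero, zero_mul]

/-- The values of `B` at a point are attained by the `*`-algebra generated by `a`: below `1/2` the
matrices `1, a, a*, a a*` are linearly independent, and at `1/2` the matrices `1, a` span the
possible values. -/
theorem exists_evalAt_polyHom_eq {F : FunAlg} (hF : MemB F) (x : HalfInterval) (z : Circle) :
    ∃ b : Poly, evalAt (polyHom b) x z = evalAt F x z := by
  have hz := Circle.coe_mul_star_coe z
  obtain hx | hx := lt_or_eq_of_le x.2.2
  · have hD : (1 - 2 * ((x : ℝ) : ℂ)) ≠ 0 := by
      have : (1 - 2 * (x : ℝ)) ≠ 0 := by linarith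
      exact_mod_cast this
    have hs := x.sqrt_mul_sqrt
    have ht := x.sqrt_one_sub_mul_sqrt_one_sub
    set s := ((√(x : ℝ) : ℝ) : ℂ) with hsdef
    set t := ((√(1 - (x : ℝ)) : ℝ) : ℂ) with htdef
    set M := evalAt F x z
    set D := 1 - 2 * ((x : ℝ) : ℂ) with hDdef
    have hDi := mul_inv_cancel₀ hD
    -- The coefficients solve two `2 × 2` systems, for the diagonal and the off-diagonal entries of
    -- `M`, both of determinant `± D`.
    refine ⟨((M 0 0 * (1 - ((x : ℝ) : ℂ)) - M 1 1 * ((x : ℝ) : ℂ)) * D⁻¹) • 1 +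
      (star (z : ℂ) * (M 1 0 * t - M 0 1 * s) * D⁻¹) • Poly.gen +
      ((z : ℂ) * (M 0 1 * t - M 1 0 * s) * D⁻¹) • star Poly.gen +
      ((M 1 1 - M 0 0) * D⁻¹) • (Poly.gen * star Poly.gen), ?_⟩
    simp only [map_add, map_smul, map_mul, map_star, polyHom_gen, evalAt_add, evalAt_smul,
      evalAt_genFun_mul_star, map_one]
    rw [evalAt_genFun, evalAt_star_genFun, ← evalHom_apply x z 1, map_one, ← hsdef, ← htdef]
    ext i j
    fin_cases i <;> fin_cases j <;> simp
    · linear_combination (M 0 0) * hDi + (M 0 0) * D⁻¹ * hDdef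
    · simp only [RCLike.star_def] at hz
      linear_combination
        ((M 1 0 * t - M 0 1 * s) * D⁻¹ * s + (M 0 1 * t - M 1 0 * s) * D⁻¹ * t) * hz +
        M 0 1 * D⁻¹ * (ht - hs) + (M 0 1) * hDi
    · simp only [RCLike.star_def] at hz
      linear_combination
        ((M 1 0 * t - M 0 1 * s) * D⁻¹ * t + (M 0 1 * t - M 1 0 * s) * D⁻¹ * s) * hz +
        M 1 0 * D⁻¹ * (ht - hs) + (M 1 0) * hDi
    · linear_combination (M 1 1) * hDi + (M 1 1) * D⁻¹ * hDdef
  · obtain rfl : x = rightEnd := Subtype.ext hx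
    obtain ⟨α, β, h⟩ := hF.exists_evalAt_rightEnd z
    have hr : ((√(1 / 2) : ℝ) : ℂ) ≠ 0 := by
      have : 0 < √(1 / 2 : ℝ) := by positivity
      exact_mod_cast this.ne'
    have h2 : (1 : ℝ) - 1 / 2 = 1 / 2 := by norm_num
    refine ⟨α • 1 + (β * star (z : ℂ) * ((√(1 / 2) : ℝ) : ℂ)⁻¹) • Poly.gen, ?_⟩
    rw [h, map_add, map_smul, map_smul, map_one, polyHom_gen, evalAt_add, evalAt_smul, evalAt_smul,
      evalAt_genFun, ← evalHom_apply rightEnd z 1, map_one]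
    simp only [rightEnd, h2]
    set r := ((√(1 / 2) : ℝ) : ℂ)
    have hri := inv_mul_cancel₀ hr
    have e : β * star (z : ℂ) * r⁻¹ * ((z : ℂ) * r) = β := by
      linear_combination β * hz + β * (z : ℂ) * star (z : ℂ) * hri
    ext i j
    fin_cases i <;> fin_cases j
    · simp
    · simpa using e
    · simpa using e
    · simp

/-- Approximation near a fibre of `coord`. -/
theorem exists_approx_near {F : FunAlg} (hF : MemB F) {ε : ℝ} (hε : 0 < ε) {w : ℂ}
    (hw : ‖w‖ ≤ 1 / 2) : ∃ b : CAR₁, ∃ U : Set ℂ, IsOpen U ∧ w ∈ U ∧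
      ∀ x z, coord x z ∈ U → ∀ i j, ‖evalAt (carHom b - F) x z i j‖ < ε := by
  obtain ⟨x₀, z₀, rfl⟩ := exists_coord_eq hw
  obtain ⟨b, hb⟩ := exists_evalAt_polyHom_eq hF x₀ z₀
  have hG : MemB (polyHom b - F) := sub_mem (polyHom_mem_B b) hF
  set G := polyHom b - F
  have h₀ : evalAt G x₀ z₀ = 0 := by rw [evalAt_sub, hb, sub_self]
  -- The compact set where `G` is not small has a closed image, which avoids the fibre.
  let K : Set (HalfInterval × Circle) := ⋃ i, ⋃ j, {p | ε ≤ ‖evalAt G p.1 p.2 i j‖}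
  have hK : IsClosed K := isClosed_iUnion_of_finite fun i => isClosed_iUnion_of_finite fun j =>
    isClosed_le continuous_const (continuous_evalAt_apply G i j).norm
  refine ⟨CAR₁.of b, ((fun p : HalfInterval × Circle => coord p.1 p.2) '' K)ᶜ,
    (hK.isCompact.image continuous_coord).isClosed.isOpen_compl, ?_, fun x z hxz i j => ?_⟩
  · rintro ⟨⟨x, z⟩, hp, hxz⟩
    simp only [K, Set.mem_iUnion] at hp
    obtain ⟨i, j, hij⟩ := hp
    have hij : ε ≤ ‖evalAt G x z i j‖ := hij
    rw [hG.evalAt_eq_zero hxz h₀, Matrix.zero_apply, norm_zero] at hij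
    exact hij.not_gt hε
  · rw [carHom_of]
    by_contra h
    exact hxz ⟨(x, z), Set.mem_iUnion.2 ⟨i, Set.mem_iUnion.2 ⟨j, not_lt.mp h⟩⟩, rfl⟩

/-- Local approximations are glued by a partition of unity on the disc of radius `1/2`, which
functional calculus turns into central elements of `CAR₁`. -/
theorem exists_norm_evalAt_carHom_sub_le {F : FunAlg} (hF : MemB F) {ε : ℝ} (hε : 0 < ε) :
    ∃ b : CAR₁, ∀ x z i j, ‖evalAt (carHom b - F) x z i j‖ ≤ ε := by
  let D : Set ℂ := Metric.closedBall 0 (1 / 2)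
  have hD : IsCompact D := isCompact_closedBall 0 (1 / 2)
  choose! b U hU hwU hb using fun (w : ℂ) (hw : w ∈ D) =>
    exists_approx_near hF hε (mem_closedBall_zero_iff.mp hw)
  obtain ⟨T, hTD, hT⟩ := hD.elim_nhds_subcover U fun w hw => (hU w hw).mem_nhds (hwU w hw)
  obtain ⟨ρ, hρ⟩ := PartitionOfUnity.exists_isSubordinate hD.isClosed (fun k : T => U k)
    (fun k => hU k (hTD k k.2)) (hT.trans (by rw [Set.iUnion_subtype]))
  have hρc (k : T) : Continuous fun w => (ρ k w : ℂ) :=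
    Complex.continuous_ofReal.comp (ρ k).continuous
  refine ⟨∑ k : T, cfc (fun w => (ρ k w : ℂ)) (CAR₁.a * CAR₁.a) * b k, fun x z i j => ?_⟩
  have hq : coord x z ∈ D := mem_closedBall_zero_iff.mpr (norm_coord_le x z)
  have hsum : ∑ k : T, ρ k (coord x z) = 1 := by
    rw [← finsum_eq_sum_of_fintype, ρ.sum_eq_one hq]
  have hval :
      evalAt (carHom (∑ k : T, cfc (fun w => (ρ k w : ℂ)) (CAR₁.a * CAR₁.a) * b k) - F) x z =
      ∑ k : T, (ρ k (coord x z) : ℂ) • evalAt (carHom (b k) - F) x z := by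
    have hF : evalAt F x z = ∑ k : T, (ρ k (coord x z) : ℂ) • evalAt F x z := by
      rw [← Finset.sum_smul, ← Complex.ofReal_sum, hsum, Complex.ofReal_one, one_smul]
    simp only [evalAt_sub, smul_sub]
    rw [Finset.sum_sub_distrib, ← hF, map_sum, evalAt_sum]
    congr 1
    refine Finset.sum_congr rfl fun k _ => ?_
    rw [map_mul, evalAt_mul, CAR₁.evalAt_carHom_cfc (hρc k), Algebra.smul_def]
  have hε' : ε = ∑ k : T, ρ k (coord x z) * ε := by rw [← Finset.sum_mul, hsum, one_mul]
  rw [hval, Matrix.sum_apply, hε']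
  refine norm_sum_le_of_le _ fun k _ => ?_
  rw [Matrix.smul_apply, norm_smul, Complex.norm_real, Real.norm_of_nonneg (ρ.nonneg k _)]
  by_cases h0 : ρ k (coord x z) = 0
  · rw [h0, zero_mul, zero_mul]
  · have hmem : coord x z ∈ U k := hρ k (subset_tsupport _ h0)
    exact mul_le_mul_of_nonneg_left (hb k (hTD k k.2) x z hmem i j).le (ρ.nonneg k _)

theorem exists_carHom_eq {F : FunAlg} (hF : F ∈ B) : ∃ b, carHom b = F := by
  have hclosed : IsClosed (Set.range carHom) :=
    antilipschitz_carHom.isClosed_range (uniformContinuous_of_continuousAt_zero carHom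
      continuous_carHom.continuousAt)
  suffices h : F ∈ closure (Set.range carHom) by rwa [hclosed.closure_eq] at h
  obtain ⟨C, hC, hbound⟩ := exists_norm_le_of_norm_evalAt_apply_le
  refine Metric.mem_closure_range_iff.2 fun ε hε => ?_
  obtain ⟨b, hb⟩ := exists_norm_evalAt_carHom_sub_le hF (ε := ε / (C + 1)) (by positivity)
  refine ⟨b, ?_⟩
  rw [dist_comm, dist_eq_norm]
  refine (hbound _ _ (by positivity) hb).trans_lt ?_
  rw [mul_div_assoc', div_lt_iff₀ (by positivity)]
  nlinarith

/-- The isomorphism of `CAR₁` onto `B`. -/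
def carEquiv : CAR₁ ≃⋆ₐ[ℂ] B :=
  StarAlgEquiv.ofBijective (carHom.codRestrict B carHom_mem_B)
    ⟨fun _ _ h => antilipschitz_carHom.injective (congrArg Subtype.val h), fun F =>
      (exists_carHom_eq F.2).imp fun _ h => Subtype.ext h⟩

end CARAlgebra
end

theorem mainTheorem8 :
    IsClosed (B : Set FunAlg) ∧
    ∃ h : CAR₁ →⋆ₐ[ℂ] FunAlg,
      (∀ (x : HalfInterval) (z : Circle),
        evalAt (h CAR₁.a) x z =
          (z : ℂ) • !![0, ((√(x : ℝ) : ℝ) : ℂ); ((√(1 - (x : ℝ)) : ℝ) : ℂ), 0]) ∧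
      (∀ g : CAR₁ →⋆ₐ[ℂ] FunAlg, g CAR₁.a = h CAR₁.a → g = h) ∧
      ∃ e : CAR₁ ≃⋆ₐ[ℂ] B, ∀ b : CAR₁, (e b : FunAlg) = h b :=
  ⟨isClosed_B, carHom, fun x z => by rw [carHom_a, evalAt_genFun],
    fun _ hg => CAR₁.starAlgHom_ext hg, carEquiv, fun _ => rfl⟩
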